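/- Let $\{-1,1\}^n$ be the $n$-dimensional hypercube graph, in which two points are adjacent if and only if they differ in exactly one coordinate. A function $f:\{-1,1\}^n\to\{-1,1\}$ is called locally $p$-biased if for every vertex $x$, $$\frac{|\{y\sim x : f(y)=1\}|}{\deg(x)}=p .$$ Two functions $f,g:\{-1,1\}^n\to\{-1,1\}$ are called isomorphic if there is an automorphism $\psi$ of the hypercube graph with $f\circ\psi=g$. Let $B_{1/n}^n$ be the class of non-isomorphic locally $1/n$-biased functions on $\{-1,1\}^n$, so that $|B_{1/n}^n|$ is the number of isomorphism classes of such functions. Then, for $n=2^k$ ranging over the powers of two, $|B_{1/n}^n|$ is super-exponential in $n$: for every constant $c>0$, $$\frac{c^{\,n}}{|B_{1/n}^n|}\longrightarrow 0\qquad\text{as } n=2^k\to\infty .$$ -/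

import Mathlib

open Filter Asymptotics

/-- The set of vertices `{-1,1}^n` of the `n`-dimensional hypercube
(`ℤˣ` is the two-element set `{-1, 1}`). -/
abbrev Cube (n : ℕ) : Type := Fin n → ℤˣ

/-- The `n`-dimensional hypercube as a graph: two points are neighbors if and only if they differ
in exactly one coordinate. -/
def hypercube (n : ℕ) : SimpleGraph (Cube n) where
  Adj x y := hammingDist x y = 1
  symm := ⟨fun x y h => by rw [hammingDist_comm]; exact h⟩
  loopless := ⟨fun x h => by simp at h⟩

instance (n : ℕ) : DecidableRel (hypercube n).Adj :=
  fun x y => inferInstanceAs (Decidable (hammingDist x y = 1))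

/-- A Boolean function `f` on the vertices of a locally finite graph is locally `p`-biased if at
every vertex `x` it takes the value `1` on exactly a `p`-fraction of the neighbors of `x`. -/
def IsLocallyBiased {V : Type*} (G : SimpleGraph V) [G.LocallyFinite] (p : ℝ) (f : V → ℤˣ) : Prop :=
  ∀ x : V, (((G.neighborFinset x).filter (fun y => f y = 1)).card : ℝ) / (G.degree x : ℝ) = p

/-- Boolean functions `f`, `g` on a graph are isomorphic if `f ∘ ψ = g` for some graph
automorphism `ψ`. -/
def IsIsomorphic {V : Type*} (G : SimpleGraph V) (f g : V → ℤˣ) : Prop :=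
  ∃ ψ : G ≃g G, f ∘ ψ = g

/-- Isomorphism, as an equivalence relation on the locally `p`-biased functions on a graph. -/
def biasedSetoid {V : Type*} (G : SimpleGraph V) [G.LocallyFinite] (p : ℝ) :
    Setoid {f : V → ℤˣ // IsLocallyBiased G p f} where
  r f g := IsIsomorphic G f.1 g.1
  iseqv :=
    { refl := fun f => ⟨RelIso.refl _, by ext x; rfl⟩
      symm := by
        rintro f g ⟨ψ, h⟩
        refine ⟨ψ.symm, ?_⟩
        rw [← h]
        funext x
        simp
      trans := by
        rintro f g k ⟨ψ, h⟩ ⟨φ, h'⟩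
        refine ⟨φ.trans ψ, ?_⟩
        rw [← h', ← h]
        rfl }

/-- The class `B_p^n` of locally `p`-biased functions on the `n`-dimensional hypercube, up to
isomorphism. -/
abbrev BiasedClass (n : ℕ) (p : ℝ) : Type := Quotient (biasedSetoid (hypercube n) p)

/-- The sequence `a` is super-exponential along the indices `n ∈ S`: it outgrows every exponential
`c ^ n` as `n → ∞` within `S`. -/
def IsSuperExponentialOn (S : Set ℕ) (a : ℕ → ℕ) : Prop :=
  ∀ c : ℝ, 0 < c → (fun n : ℕ => c ^ n) =o[atTop ⊓ 𝓟 S] (fun n : ℕ => (a n : ℝ))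

/-! The indicator of a set meeting every neighborhood exactly once is locally `1/n`-biased. From
such a set `T` in dimension `m`, doubling (`doubledCode`) gives one in dimension `n = 2m` for each
sign function on `T`, all distinct. Since `|T| ≥ 2^m / m`, this gives doubly exponentially many
biased functions. An automorphism is determined by its values on a unit ball, so a class has at most
`2^(n+n^2)` members, and at least `2^(n^2)` classes remain once `n` is a large power of two. -/

/-- The neighbor of `1` in the hypercube in direction `i`; multiplying by it flips the
coordinate `i`. -/
abbrev flipAt {n : ℕ} (i : Fin n) : Cube n := Pi.mulSingle i (-1)

lemma flip_mul_self {n : ℕ} (i : Fin n) : flipAt i * flipAt i = 1 := by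
  simp [flipAt, ← Pi.mulSingle_mul]

lemma mul_flip_mul_flip {n : ℕ} (x : Cube n) (i : Fin n) : x * flipAt i * flipAt i = x := by
  rw [mul_assoc, flip_mul_self, mul_one]

lemma flip_injective {n : ℕ} : Function.Injective (flipAt : Fin n → Cube n) := by
  intro i j h
  by_contra hij
  have := congrFun h i
  simp [flipAt, Pi.mulSingle_eq_of_ne hij] at this

lemma hypercube_adj_iff {n : ℕ} {x y : Cube n} :
    (hypercube n).Adj x y ↔ ∃ i, y = x * flipAt i := by
  change hammingDist x y = 1 ↔ _
  rw [hammingDist, Finset.card_eq_one]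
  refine exists_congr fun i => ?_
  rw [Finset.ext_iff, funext_iff]
  refine forall_congr' fun j => ?_
  by_cases h : j = i
  · subst h
    rcases Int.units_eq_one_or (x j) with hx | hx <;>
      rcases Int.units_eq_one_or (y j) with hy | hy <;> simp [hx, hy]
  · simp [h, eq_comm]

lemma hypercube_adj_mul_flip {n : ℕ} (x : Cube n) (i : Fin n) :
    (hypercube n).Adj x (x * flipAt i) :=
  hypercube_adj_iff.2 ⟨i, rfl⟩

/-! ### Automorphisms of the hypercube -/

lemma eq_mul_flip_mul_flip_of_adj {n : ℕ} {a d : Cube n} {i j : Fin n} (hij : i ≠ j)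
    (hi : (hypercube n).Adj (a * flipAt i) d) (hj : (hypercube n).Adj (a * flipAt j) d)
    (had : d ≠ a) : d = a * flipAt i * flipAt j := by
  obtain ⟨k, hk⟩ := hypercube_adj_iff.1 hi
  obtain ⟨l, hl⟩ := hypercube_adj_iff.1 hj
  by_cases hkj : k = j
  · rw [hk, hkj]
  have hlj : l ≠ j := by
    rintro rfl
    exact had (by rw [hl, mul_flip_mul_flip])
  -- At coordinate `j` the first expression for `d` agrees with `a`, the second does not.
  have h := congrFun (hk.symm.trans hl) j
  simp [Pi.mulSingle_eq_of_ne hij.symm, Pi.mulSingle_eq_of_ne (Ne.symm hkj),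
    Pi.mulSingle_eq_of_ne hlj.symm] at h

/-- Two vertices at distance two have at most one common neighbor besides a given one. -/
lemma hypercube_common_neighbor_unique {n : ℕ} {a b c d d' : Cube n} (hbc : b ≠ c)
    (hab : (hypercube n).Adj a b) (hac : (hypercube n).Adj a c)
    (hbd : (hypercube n).Adj b d) (hcd : (hypercube n).Adj c d) (hd : d ≠ a)
    (hbd' : (hypercube n).Adj b d') (hcd' : (hypercube n).Adj c d') (hd' : d' ≠ a) :
    d = d' := by
  obtain ⟨i, rfl⟩ := hypercube_adj_iff.1 hab
  obtain ⟨j, rfl⟩ := hypercube_adj_iff.1 hac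
  have hij : i ≠ j := fun h => hbc (by rw [h])
  rw [eq_mul_flip_mul_flip_of_adj hij hbd hcd hd, eq_mul_flip_mul_flip_of_adj hij hbd' hcd' hd']

lemma cube_induction {n : ℕ} {P : Cube n → Prop} (one : P 1)
    (mul_flip : ∀ x i, P x → P (x * flipAt i)) (x : Cube n) : P x := by
  rw [← Finset.univ_prod_mulSingle x]
  induction (Finset.univ : Finset (Fin n)) using Finset.induction_on with
  | empty => simpa using one
  | insert i s hi ih =>
    rw [Finset.prod_insert hi, mul_comm]
    rcases Int.units_eq_one_or (x i) with h | h
    · simpa [h] using ih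
    · rw [h]
      exact mul_flip _ _ ih

/-- An automorphism of the hypercube is determined by its values on a closed unit ball. -/
lemma hypercube_iso_ext {n : ℕ} {σ τ : hypercube n ≃g hypercube n} (h1 : σ 1 = τ 1)
    (hflip : ∀ i, σ (flipAt i) = τ (flipAt i)) : σ = τ := by
  -- The induction carries agreement on the whole closed ball around `x`.
  suffices h : ∀ x, σ x = τ x ∧ ∀ i, σ (x * flipAt i) = τ (x * flipAt i) from
    RelIso.ext fun x => (h x).1
  refine cube_induction ⟨h1, fun i => by simpa using hflip i⟩ ?_
  rintro x j ⟨hx, hxi⟩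
  refine ⟨hxi j, fun i => ?_⟩
  by_cases hij : j = i
  · rw [hij, mul_flip_mul_flip, hx]
  have hne : x * flipAt j * flipAt i ≠ x := by
    rw [mul_assoc]
    intro h
    have h' : flipAt j * flipAt i = 1 := by simpa using h
    apply hij
    apply flip_injective
    calc flipAt j = flipAt j * flipAt i * flipAt i := (mul_flip_mul_flip _ _).symm
      _ = flipAt i := by rw [h', one_mul]
  have hadj : (hypercube n).Adj (x * flipAt i) (x * flipAt j * flipAt i) := by
    rw [mul_right_comm]
    exact hypercube_adj_mul_flip _ _
  refine hypercube_common_neighbor_unique (a := σ x) (b := σ (x * flipAt j))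
    (c := σ (x * flipAt i)) ?_ (σ.map_adj_iff.2 (hypercube_adj_mul_flip _ _))
    (σ.map_adj_iff.2 (hypercube_adj_mul_flip _ _))
    (σ.map_adj_iff.2 (hypercube_adj_mul_flip _ _)) (σ.map_adj_iff.2 hadj)
    (fun h => hne (σ.injective h)) ?_ ?_ ?_
  · intro h
    exact hij (flip_injective (mul_left_cancel (σ.injective h)))
  · rw [hxi]
    exact τ.map_adj_iff.2 (hypercube_adj_mul_flip _ _)
  · rw [hxi]
    exact τ.map_adj_iff.2 hadj
  · rw [hx]
    exact fun h => hne (τ.injective h)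

/-- Each isomorphism class contains at most `|Aut|` functions, hence at most `2 ^ (n + n * n)`. -/
lemma card_biased_le (n : ℕ) (p : ℝ) :
    Nat.card {f : Cube n → ℤˣ // IsLocallyBiased (hypercube n) p f} ≤
      Nat.card (BiasedClass n p) * 2 ^ (n + n * n) := by
  have hiso (g : {f : Cube n → ℤˣ // IsLocallyBiased (hypercube n) p f}) :
      ∃ ψ : hypercube n ≃g hypercube n,
        (Quotient.mk (biasedSetoid (hypercube n) p) g).out.1 ∘ ψ = g.1 :=
    Quotient.mk_out (s := biasedSetoid (hypercube n) p) g
  choose ψ hψ using hiso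
  -- The class fixes a representative; the images of the unit ball fix the automorphism carrying it
  -- to `g`.
  let F : {f : Cube n → ℤˣ // IsLocallyBiased (hypercube n) p f} →
      BiasedClass n p × Cube n × (Fin n → Cube n) :=
    fun g => (Quotient.mk _ g, ψ g 1, fun i => ψ g (flipAt i))
  have hF : Function.Injective F := by
    intro g g' h
    simp only [F, Prod.mk.injEq] at h
    obtain ⟨hq, h1, h2⟩ := h
    have hψ' : ψ g = ψ g' := hypercube_iso_ext h1 (congrFun h2)
    apply Subtype.ext
    rw [← hψ g, ← hψ g', hq, hψ']
  calc _ ≤ Nat.card (BiasedClass n p × Cube n × (Fin n → Cube n)) :=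
        Nat.card_le_card_of_injective F hF
    _ = _ := by
        simp [Nat.card_prod, pow_add, pow_mul]

/-! ### Total perfect codes -/

/-- A set of vertices such that every vertex of the cube has exactly one neighbor in it. -/
def IsTotalPerfectCode {n : ℕ} (T : Set (Cube n)) : Prop :=
  ∀ x : Cube n, ∃! i, x * flipAt i ∈ T

open Classical in
lemma IsTotalPerfectCode.isLocallyBiased {n : ℕ} {T : Set (Cube n)}
    (hT : IsTotalPerfectCode T) :
    IsLocallyBiased (hypercube n) (1 / (n : ℝ)) (fun x => if x ∈ T then 1 else -1) := by
  intro x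
  have hN : (hypercube n).neighborFinset x = Finset.univ.image fun i => x * flipAt i := by
    ext y
    simp [hypercube_adj_iff, eq_comm]
  have hinj : Function.Injective fun i : Fin n => x * flipAt i :=
    fun i j h => flip_injective (mul_left_cancel h)
  have hdeg : (hypercube n).degree x = n := by
    rw [← SimpleGraph.card_neighborFinset_eq_degree, hN, Finset.card_image_of_injective _ hinj]
    simp
  have hcard : (((hypercube n).neighborFinset x).filter
      fun y => (if y ∈ T then (1 : ℤˣ) else -1) = 1).card = 1 := by
    obtain ⟨i, hi, huniq⟩ := hT x
    rw [Finset.card_eq_one]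
    refine ⟨x * flipAt i, ?_⟩
    ext y
    have hite : ((if y ∈ T then (1 : ℤˣ) else -1) = 1) ↔ y ∈ T := by
      split_ifs with h <;> simp [h]
    rw [Finset.mem_filter, hite, hN, Finset.mem_singleton]
    constructor
    · rintro ⟨hy, hyT⟩
      obtain ⟨j, -, rfl⟩ := Finset.mem_image.1 hy
      rw [huniq j hyT]
    · rintro rfl
      exact ⟨Finset.mem_image_of_mem _ (Finset.mem_univ i), hi⟩
  rw [hdeg, hcard, Nat.cast_one]

/-- The `n`-point neighborhoods of the points of `T` cover the cube. -/
lemma IsTotalPerfectCode.two_pow_le {n : ℕ} {T : Set (Cube n)} (hT : IsTotalPerfectCode T) :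
    2 ^ n ≤ Nat.card T * n := by
  have hs : Function.Surjective fun p : T × Fin n => p.1.1 * flipAt p.2 := by
    intro x
    obtain ⟨i, hi, -⟩ := hT x
    exact ⟨(⟨_, hi⟩, i), mul_flip_mul_flip x i⟩
  simpa [Nat.card_prod] using Nat.card_le_card_of_surjective _ hs

/-- The coordinatewise product of the two halves of a vertex. -/
def foldHalves {m : ℕ} (x : Cube (m + m)) : Cube m :=
  fun i => x (Fin.castAdd m i) * x (Fin.natAdd m i)

/-- The parity of the second half of a vertex. -/
def sndParity {m : ℕ} (x : Cube (m + m)) : ℤˣ := ∏ i, x (Fin.natAdd m i)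

lemma foldHalves_mul {m : ℕ} (x y : Cube (m + m)) :
    foldHalves (x * y) = foldHalves x * foldHalves y := by
  ext i : 1
  exact mul_mul_mul_comm _ _ _ _

lemma sndParity_mul {m : ℕ} (x y : Cube (m + m)) :
    sndParity (x * y) = sndParity x * sndParity y :=
  Finset.prod_mul_distrib

lemma castAdd_ne_natAdd {m : ℕ} (a b : Fin m) : Fin.castAdd m a ≠ Fin.natAdd m b := by
  intro h
  have := congrArg Fin.val h
  simp at this
  omega

lemma foldHalves_flip_castAdd {m : ℕ} (a : Fin m) :
    foldHalves (flipAt (Fin.castAdd m a)) = flipAt a := by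
  ext i : 1
  by_cases h : i = a
  · subst h
    simp [-Fin.natAdd_eq_addNat, foldHalves, Pi.mulSingle_eq_of_ne (castAdd_ne_natAdd i i).symm]
  · have h' : Fin.castAdd m i ≠ Fin.castAdd m a := fun e => h (Fin.castAdd_injective m m e)
    simp [-Fin.natAdd_eq_addNat, foldHalves, Pi.mulSingle_eq_of_ne (castAdd_ne_natAdd a i).symm,
      Pi.mulSingle_eq_of_ne h, Pi.mulSingle_eq_of_ne h']

lemma foldHalves_flip_natAdd {m : ℕ} (a : Fin m) :
    foldHalves (flipAt (Fin.natAdd m a)) = flipAt a := by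
  ext i : 1
  by_cases h : i = a
  · subst h
    simp [-Fin.natAdd_eq_addNat, foldHalves, Pi.mulSingle_eq_of_ne (castAdd_ne_natAdd i i)]
  · have h' : Fin.natAdd m i ≠ Fin.natAdd m a := fun e => h (Fin.natAdd_injective m m e)
    simp [-Fin.natAdd_eq_addNat, foldHalves, Pi.mulSingle_eq_of_ne (castAdd_ne_natAdd i a),
      Pi.mulSingle_eq_of_ne h, Pi.mulSingle_eq_of_ne h']

lemma sndParity_flip_castAdd {m : ℕ} (a : Fin m) :
    sndParity (flipAt (Fin.castAdd m a)) = 1 :=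
  Finset.prod_eq_one fun i _ => Pi.mulSingle_eq_of_ne (castAdd_ne_natAdd a i).symm _

lemma sndParity_flip_natAdd {m : ℕ} (a : Fin m) :
    sndParity (flipAt (Fin.natAdd m a)) = -1 := by
  rw [sndParity, Finset.prod_eq_single a]
  · simp
  · intro b _ hb
    exact Pi.mulSingle_eq_of_ne (fun e => hb (Fin.natAdd_injective m m e)) _
  · simp

/-- The Vasil'ev-type doubling of a set `T`, twisted by an arbitrary sign function on `T`. -/
def doubledCode {m : ℕ} (T : Set (Cube m)) (l : T → ℤˣ) : Set (Cube (m + m)) :=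
  {x | ∃ h : foldHalves x ∈ T, sndParity x = l ⟨foldHalves x, h⟩}

lemma mem_doubledCode {m : ℕ} {T : Set (Cube m)} {l : T → ℤˣ} {x : Cube (m + m)} :
    x ∈ doubledCode T l ↔ ∃ h : foldHalves x ∈ T, sndParity x = l ⟨foldHalves x, h⟩ :=
  Iff.rfl

/-- The unique direction from `foldHalves x` into `T` lifts to two directions, one in each half.
Only the second flips `sndParity`, so exactly one meets the sign condition. -/
lemma IsTotalPerfectCode.doubledCode {m : ℕ} {T : Set (Cube m)} (hT : IsTotalPerfectCode T)
    (l : T → ℤˣ) : IsTotalPerfectCode (doubledCode T l) := by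
  intro x
  obtain ⟨a, ha, huniq⟩ := hT (foldHalves x)
  have hc (b : Fin m) : x * flipAt (Fin.castAdd m b) ∈ _root_.doubledCode T l ↔
      ∃ h : foldHalves x * flipAt b ∈ T, sndParity x = l ⟨_, h⟩ := by
    simp only [mem_doubledCode, foldHalves_mul, sndParity_mul,
      foldHalves_flip_castAdd, sndParity_flip_castAdd, mul_one]
  have hn (b : Fin m) : x * flipAt (Fin.natAdd m b) ∈ _root_.doubledCode T l ↔
      ∃ h : foldHalves x * flipAt b ∈ T, sndParity x = -l ⟨_, h⟩ := by
    simp only [mem_doubledCode, foldHalves_mul, sndParity_mul,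
      foldHalves_flip_natAdd, sndParity_flip_natAdd, mul_neg, mul_one, neg_eq_iff_eq_neg]
  by_cases hx : sndParity x = l ⟨_, ha⟩
  · refine ⟨Fin.castAdd m a, (hc a).2 ⟨ha, hx⟩, fun j => ?_⟩
    refine Fin.addCases (fun b hb => ?_) (fun b hb => ?_) j
    · rw [huniq b ((hc b).1 hb).1]
    · obtain ⟨h, hb⟩ := (hn b).1 hb
      obtain rfl := huniq b h
      exact absurd (hx.symm.trans hb) (units_ne_neg_self _)
  · refine ⟨Fin.natAdd m a, (hn a).2 ⟨ha, Int.units_ne_iff_eq_neg.1 hx⟩, fun j => ?_⟩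
    refine Fin.addCases (fun b hb => ?_) (fun b hb => ?_) j
    · obtain ⟨h, hb⟩ := (hc b).1 hb
      obtain rfl := huniq b h
      exact absurd hb hx
    · rw [huniq b ((hn b).1 hb).1]

lemma doubledCode_injective {m : ℕ} (hm : 0 < m) (T : Set (Cube m)) :
    Function.Injective (doubledCode T) := by
  intro l l' h
  ext1 ⟨w, hw⟩
  -- Folding `(w * z, z)` gives `w` for every `z`; a single nontrivial coordinate gives `z` the
  -- parity `l w`.
  let z : Cube m := Pi.mulSingle ⟨0, hm⟩ (l ⟨w, hw⟩)
  let x : Cube (m + m) := Fin.append (w * z) z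
  have hf : foldHalves x = w := by
    ext i : 1
    have hz : z i * z i = 1 := Int.units_mul_self _
    simp only [foldHalves, x, Fin.append_left, Fin.append_right, Pi.mul_apply, mul_assoc, hz,
      mul_one]
  have hs : sndParity x = l ⟨w, hw⟩ := by
    simp only [sndParity, x, z, Fin.append_right, Finset.prod_pi_mulSingle', Finset.mem_univ,
      if_true]
  have hx : x ∈ doubledCode T l := ⟨hf.symm ▸ hw, by simp only [hf, hs]⟩
  rw [h] at hx
  obtain ⟨_, hx⟩ := hx
  simpa only [hf, hs] using hx

lemma exists_isTotalPerfectCode (k : ℕ) :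
    ∃ T : Set (Cube (2 ^ k)), IsTotalPerfectCode T := by
  induction k with
  -- In dimension one each vertex has a single neighbor.
  | zero => exact ⟨Set.univ, fun x => ⟨0, trivial, fun j _ => Fin.fin_one_eq_zero j⟩⟩
  | succ k ih =>
    obtain ⟨T, hT⟩ := ih
    rw [pow_succ, mul_two]
    exact ⟨_, hT.doubledCode fun _ => 1⟩

/-! ### Counting -/

open Classical in
lemma two_pow_card_le_card_biased {m : ℕ} (hm : 0 < m) {T : Set (Cube m)}
    (hT : IsTotalPerfectCode T) :
    2 ^ Nat.card T ≤ Nat.card {f : Cube (m + m) → ℤˣ //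
      IsLocallyBiased (hypercube (m + m)) (1 / ((m + m : ℕ) : ℝ)) f} := by
  let F : (T → ℤˣ) → {f : Cube (m + m) → ℤˣ //
      IsLocallyBiased (hypercube (m + m)) (1 / ((m + m : ℕ) : ℝ)) f} :=
    fun l => ⟨_, (hT.doubledCode l).isLocallyBiased⟩
  have hF : Function.Injective F := by
    intro l l' h
    apply doubledCode_injective hm
    ext x
    have := congrFun (congrArg Subtype.val h) x
    simp only [F] at this
    by_cases h1 : x ∈ doubledCode T l <;> by_cases h2 : x ∈ doubledCode T l' <;>
      simp_all
  have := Nat.card_le_card_of_injective F hF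
  simpa [Nat.card_fun] using this

lemma two_pow_sq_le_card_biasedClass {m : ℕ} (hm : 0 < m)
    (hle : m * (2 * (m + m) * (m + m) + (m + m)) ≤ 2 ^ m) {T : Set (Cube m)}
    (hT : IsTotalPerfectCode T) :
    2 ^ ((m + m) * (m + m)) ≤ Nat.card (BiasedClass (m + m) (1 / ((m + m : ℕ) : ℝ))) := by
  -- With `n = m + m`, `2n² + n` is the target exponent `n²` plus the `n + n²` lost to
  -- automorphisms.
  have hcard : 2 * (m + m) * (m + m) + (m + m) ≤ Nat.card T := by
    refine Nat.le_of_mul_le_mul_left (hle.trans ?_) hm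
    rw [mul_comm m]
    exact hT.two_pow_le
  refine Nat.le_of_mul_le_mul_right ?_ (pow_pos two_pos (m + m + (m + m) * (m + m)))
  refine le_trans ?_ ((two_pow_card_le_card_biased hm hT).trans (card_biased_le _ _))
  rw [← pow_add]
  refine Nat.pow_le_pow_right two_pos (le_trans (le_of_eq ?_) hcard)
  ring

lemma eventually_cubic_le_two_pow :
    ∀ᶠ m : ℕ in atTop, m * (2 * (m + m) * (m + m) + (m + m)) ≤ 2 ^ m := by
  have h := (tendsto_pow_const_div_const_pow_of_one_lt 3 (one_lt_two : (1 : ℝ) < 2)).eventually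
    (gt_mem_nhds (show (0 : ℝ) < 1 / 10 by norm_num))
  filter_upwards [h] with m hm
  rw [div_lt_iff₀ (by positivity)] at hm
  -- The left side is `8m³ + 2m²`.
  have h1 : m * (2 * (m + m) * (m + m) + (m + m)) ≤ 10 * m ^ 3 := by
    have : m * m ≤ m * m * m := by
      rcases Nat.eq_zero_or_pos m with rfl | h
      · simp
      · exact Nat.le_mul_of_pos_right _ h
    nlinarith
  refine h1.trans ?_
  have : (10 : ℝ) * (m : ℝ) ^ 3 ≤ 2 ^ m := by linarith
  exact_mod_cast this

lemma pow_isLittleO_two_pow_sq (c : ℝ) :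
    (fun n : ℕ => c ^ n) =o[atTop] fun n : ℕ => (2 : ℝ) ^ (n * n) := by
  have hlin : ∀ᶠ n : ℕ in atTop, 2 * |c| ≤ (2 : ℝ) ^ n :=
    (tendsto_pow_atTop_atTop_of_one_lt (one_lt_two : (1 : ℝ) < 2)).eventually_ge_atTop _
  rw [isLittleO_iff]
  intro ε hε
  have hhalf := (tendsto_pow_atTop_nhds_zero_of_lt_one (by norm_num : (0 : ℝ) ≤ 1 / 2)
    (by norm_num)).eventually (gt_mem_nhds hε)
  filter_upwards [hlin, hhalf] with n h1 h2
  rw [Real.norm_eq_abs, abs_pow, Real.norm_of_nonneg (by positivity)]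
  -- Replacing `|c|` by `2^n / 2` leaves a spare factor `(1/2)^n`.
  calc |c| ^ n ≤ (1 / 2 * 2 ^ n) ^ n := by
        gcongr
        linarith
    _ = (1 / 2) ^ n * 2 ^ (n * n) := by rw [mul_pow, pow_mul]
    _ ≤ ε * 2 ^ (n * n) := by gcongr

theorem mainTheorem5 :
    IsSuperExponentialOn {n : ℕ | ∃ k : ℕ, n = 2 ^ k}
      (fun n : ℕ => Nat.card (BiasedClass n (1 / (n : ℝ)))) := by
  intro c _
  refine ((pow_isLittleO_two_pow_sq c).mono inf_le_left).trans_isBigO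
    (IsBigO.of_bound 1 (eventually_inf_principal.2 ?_))
  have hhalf : Tendsto (fun n : ℕ => n / 2) atTop atTop :=
    Nat.tendsto_div_const_atTop two_ne_zero
  -- The bound `n ≥ 2` rules out `n = 2^0`, so `n` is twice a power of two.
  filter_upwards [hhalf.eventually eventually_cubic_le_two_pow, eventually_ge_atTop 2]
    with n hn hn2
  rintro ⟨k, hk⟩
  rcases k with _ | k
  · simp at hk
    omega
  obtain ⟨T, hT⟩ := exists_isTotalPerfectCode k
  have hkn : n = 2 ^ k + 2 ^ k := by rw [hk, pow_succ, mul_two]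
  rw [show n / 2 = 2 ^ k by omega] at hn
  subst hkn
  rw [one_mul, Real.norm_of_nonneg (by positivity), Real.norm_of_nonneg (by positivity)]
  exact_mod_cast two_pow_sq_le_card_biasedClass (by positivity) hn hT
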